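/- **Theorem (CLT on the $p$-adic solenoid).** Let $p$ be a prime, let $\mathbb{T}=\{z\in\mathbb{C}:|z|=1\}$, and let $$S_p=\{(y_0,y_1,\dots)\in\mathbb{T}^{\infty}: y_j=y_{j+1}^p \text{ for all } j\ge 0\}$$ be the $p$-adic solenoid, a compact Abelian group under componentwise multiplication with the topology of $\mathbb{T}^\infty$; its group operation is written additively below and its identity is denoted by $e$. Its characters are $\chi_{d,\ell}(y)=y_d^\ell$, $d\in\mathbb{Z}_+=\{0,1,2,\dots\}$, $\ell\in\mathbb{Z}$. For $b\ge 0$ let $\psi_b(\chi_{d,\ell})=b\ell^2/p^{2d}$, and let $\gamma_{\psi_b}$ be the unique Borel probability measure on $S_p$ with Fourier transform $\int_{S_p}\chi\,d\gamma_{\psi_b}=e^{-\psi_b(\chi)/2}$ for every character $\chi$ of $S_p$ (a symmetric Gauss measure). Let $\arg:\mathbb{T}\to[-\pi,\pi)$ be given by $\arg(e^{ix})=x$ for $-\pi\le x<\pi$. Let $\{X_{n,k}:n\in\mathbb{N},\ k=1,\dots,K_n\}$ be a rowwise independent array of random elements of $S_p$. Suppose that there exist $a=(a_0,a_1,\dots)\in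 S_p$ and $b\ge 0$ such that, as $n\to\infty$, 1. $\exp\Big\{\dfrac{i}{p^d}\sum_{k=1}^{K_n}\mathrm{E}\arg\big((X_{n,k})_0\big)\Big\}\to a_d$ for all $d\in\mathbb{Z}_+$; 2. $\sum_{k=1}^{K_n}\mathrm{Var}\arg\big((X_{n,k})_0\big)\to b$; 3. $\sum_{k=1}^{K_n}\mathrm{P}\big(\exists\, j\le d:\ |\arg((X_{n,k})_j)|>\varepsilon\big)\to 0$ for all $d\in\mathbb{Z}_+$ and all $\varepsilon>0$. Then the array is infinitesimal, i.e. $\max_{1\le k\le K_n}\mathrm{P}(X_{n,k}\in S_p\setminus U)\to 0$ as $n\to\infty$ for every Borel neighbourhood $U$ of $e$, and the row sums $\sum_{k=1}^{K_n}X_{n,k}$ converge in distribution to $\delta_a*\gamma_{\psi_b}$ as $n\to\infty$. -/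

import Mathlib

open Filter Topology MeasureTheory ProbabilityTheory
open scoped NNReal

noncomputable section

/-- The `p`-adic solenoid `S_p`: the sequences `(y₀, y₁, …)` in the infinite torus such that
`y_j = y_{j+1} ^ p` for all `j`. It is written multiplicatively (componentwise multiplication)
and has the topology induced by the product topology. -/
def solenoid (p : ℕ) : Subgroup (ℕ → Circle) where
  carrier := {y | ∀ j, y j = y (j + 1) ^ p}
  one_mem' := by intro j; simp
  mul_mem' := by
    intro x y hx hy j
    simp only [Pi.mul_apply, mul_pow, hx j, hy j]
  inv_mem' := by
    intro x hx j
    simp only [Pi.inv_apply, inv_pow, hx j]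

namespace solenoid

variable {p : ℕ}

/-- `S_p` carries its Borel `σ`-algebra. -/
instance : MeasurableSpace (solenoid p) := borel _

instance : BorelSpace (solenoid p) := ⟨rfl⟩

theorem isClosed_carrier : IsClosed (solenoid p : Set (ℕ → Circle)) := by
  have : (solenoid p : Set (ℕ → Circle)) = ⋂ j : ℕ, {y | y j = y (j + 1) ^ p} := by
    ext y; simp [solenoid]
  rw [this]
  exact isClosed_iInter fun j => isClosed_eq (by fun_prop) (by fun_prop)

instance : CompactSpace (solenoid p) :=
  isCompact_iff_compactSpace.mp isClosed_carrier.isCompact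

instance : SecondCountableTopology (solenoid p) :=
  inferInstanceAs (SecondCountableTopology (solenoid p : Set (ℕ → Circle)))

theorem coord_eq_pow (y : solenoid p) (d e : ℕ) : y.1 d = y.1 (d + e) ^ p ^ e := by
  induction e with
  | zero => simp
  | succ e ih => rw [ih, y.2 (d + e), ← pow_mul, pow_succ', add_assoc]

/-- The character `χ_{d,ℓ}(y) = y_d ^ ℓ` of `S_p`. -/
def char (p d : ℕ) (l : ℤ) : PontryaginDual (solenoid p) :=
  ContinuousMonoidHom.mk
    (MonoidHom.mk' (fun y : solenoid p => y.1 d ^ l) fun x y => by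
      simp [mul_zpow])
    (by
      show Continuous fun y : solenoid p => y.1 d ^ l
      exact ((continuous_apply d).comp continuous_subtype_val).zpow l)

@[simp]
theorem char_apply (d : ℕ) (l : ℤ) (y : solenoid p) : char p d l y = y.1 d ^ l := rfl

theorem char_eq_char_add (d e : ℕ) (l : ℤ) :
    char p d l = char p (d + e) (p ^ e * l) := by
  ext y
  rw [char_apply, char_apply, coord_eq_pow y d e, zpow_mul]
  norm_cast

theorem exists_char_mul (d d' : ℕ) (l l' : ℤ) :
    ∃ (m : ℕ) (k : ℤ), char p d l * char p d' l' = char p m k := by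
  refine ⟨d + d', p ^ d' * l + p ^ d * l', ?_⟩
  rw [char_eq_char_add d d' l, char_eq_char_add d' d l', add_comm d' d]
  refine PontryaginDual.ext fun y => ?_
  exact (zpow_add (y.1 (d + d')) _ _).symm

/-- The one-parameter subgroup `t ↦ (e^{it/p^j})_j` of `S_p`. -/
def flow (p : ℕ) [hp : Fact p.Prime] (t : ℝ) : solenoid p :=
  ⟨fun j => Circle.exp (t / p ^ j), fun j => by
    have : (p : ℝ) ≠ 0 := by exact_mod_cast hp.out.ne_zero
    rw [← Circle.exp_nsmul, nsmul_eq_mul]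
    rw [pow_succ]
    field_simp⟩

theorem continuous_flow [Fact p.Prime] : Continuous (flow p) := by
  refine Continuous.subtype_mk ?_ _
  exact continuous_pi fun j => Circle.exp.continuous.comp (by fun_prop)

theorem char_flow [Fact p.Prime] (d : ℕ) (l : ℤ) (t : ℝ) :
    char p d l (flow p t) = Circle.exp ((l / p ^ d) * t) := by
  rw [char_apply]
  show Circle.exp (t / p ^ d) ^ l = _
  rw [← Circle.exp_zsmul, zsmul_eq_mul]
  congr 1
  ring

/-- The number `ℓ / p^d` is determined by the character `χ_{d,ℓ}`. -/
theorem freq_unique [Fact p.Prime] {d d' : ℕ} {l l' : ℤ} (h : char p d l = char p d' l') :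
    (l / p ^ d : ℝ) = l' / p ^ d' := by
  by_contra hne
  set s : ℝ := l / p ^ d - l' / p ^ d' with hs
  have hs0 : s ≠ 0 := sub_ne_zero.mpr hne
  have h1 := char_flow (p := p) d l (Real.pi / s)
  rw [h, char_flow] at h1
  have h2 : Circle.exp (s * (Real.pi / s)) = 1 := by
    rw [hs, sub_mul, Circle.exp_sub, ← hs, h1, div_self']
  rw [mul_div_cancel₀ _ hs0, Circle.exp_eq_one] at h2
  obtain ⟨n, hn⟩ := h2
  have h3 : (1 : ℝ) = n * 2 := by
    have := Real.pi_ne_zero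
    field_simp at hn
    linarith
  have h4 : (1 : ℤ) = n * 2 := by exact_mod_cast h3
  omega

/-- A character as a continuous complex-valued function. -/
def toC (χ : PontryaginDual (solenoid p)) : C(solenoid p, ℂ) :=
  ⟨fun y => (χ y : ℂ), continuous_subtype_val.comp (map_continuous χ)⟩

theorem toC_apply (χ : PontryaginDual (solenoid p)) (y : solenoid p) : toC χ y = (χ y : ℂ) := rfl

/-- Trigonometric polynomials built from the characters `χ_{d,ℓ}` are uniformly dense. -/
theorem exists_span_near (f : C(solenoid p, ℂ)) {ε : ℝ} (hε : 0 < ε) :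
    ∃ g ∈ Submodule.span ℂ (Set.range fun q : ℕ × ℤ => toC (char p q.1 q.2)),
      ∀ y, ‖f y - g y‖ < ε := by
  set R : Set C(solenoid p, ℂ) := Set.range fun q : ℕ × ℤ => toC (char p q.1 q.2) with hR
  let A : StarSubalgebra ℂ C(solenoid p, ℂ) :=
    { toSubalgebra := Algebra.adjoin ℂ R
      star_mem' := by
        change Algebra.adjoin ℂ R ≤ star (Algebra.adjoin ℂ R)
        refine Algebra.adjoin_le ?_
        rintro - ⟨⟨d, l⟩, rfl⟩
        refine Algebra.subset_adjoin ⟨(d, -l), ?_⟩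
        ext y
        simp [toC_apply, ← Circle.coe_inv_eq_conj] }
  have hspan : Subalgebra.toSubmodule (Algebra.adjoin ℂ R) = Submodule.span ℂ R := by
    apply Algebra.adjoin_eq_span_of_subset
    refine Set.Subset.trans ?_ Submodule.subset_span
    intro x hx
    refine Submonoid.closure_induction (fun _ => id) ⟨(0, 0), ?_⟩ ?_ hx
    · ext y; simp [toC_apply]
    · rintro - - - - ⟨⟨d, l⟩, rfl⟩ ⟨⟨d', l'⟩, rfl⟩
      obtain ⟨m, k, h⟩ := exists_char_mul (p := p) d d' l l'
      refine ⟨(m, k), ?_⟩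
      ext y
      show ((char p m k) y : ℂ) = (char p d l y : ℂ) * (char p d' l' y : ℂ)
      rw [← h, ← Circle.coe_mul]
      rfl
  have hsep : A.SeparatesPoints := by
    intro x y hxy
    obtain ⟨d, hd⟩ : ∃ d, x.1 d ≠ y.1 d := by
      by_contra! h
      exact hxy (Subtype.ext (funext h))
    refine ⟨_, ⟨toC (char p d 1), Algebra.subset_adjoin ⟨(d, 1), rfl⟩, rfl⟩, ?_⟩
    simpa [toC_apply, Circle.ext_iff] using hd
  have htop := ContinuousMap.starSubalgebra_topologicalClosure_eq_top_of_separatesPoints A hsep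
  have hf : f ∈ A.topologicalClosure := by rw [htop]; trivial
  have hf' : f ∈ closure (A : Set C(solenoid p, ℂ)) := hf
  obtain ⟨g, hg, hfg⟩ := Metric.mem_closure_iff.mp hf' ε hε
  refine ⟨g, ?_, fun y => ?_⟩
  · rw [← hspan]; exact hg
  · rw [dist_eq_norm] at hfg
    exact ((f - g).norm_coe_le_norm y).trans_lt hfg

theorem integrable_C (μ : Measure (solenoid p)) [IsFiniteMeasure μ] (f : C(solenoid p, ℂ)) :
    Integrable (fun y => f y) μ :=
  Integrable.of_bound f.continuous.aestronglyMeasurable ‖f‖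
    (ae_of_all _ fun y => f.norm_coe_le_norm y)

/-- A probability measure on `S_p` is determined by its Fourier transform. -/
theorem measure_ext (μ ν : Measure (solenoid p)) [IsProbabilityMeasure μ] [IsProbabilityMeasure ν]
    (h : ∀ d l, ∫ y, (char p d l y : ℂ) ∂μ = ∫ y, (char p d l y : ℂ) ∂ν) : μ = ν := by
  have hs : ∀ g ∈ Submodule.span ℂ (Set.range fun q : ℕ × ℤ => toC (char p q.1 q.2)),
      ∫ y, g y ∂μ = ∫ y, g y ∂ν := by
    intro g hg
    induction hg using Submodule.span_induction with
    | mem x hx => obtain ⟨⟨d, l⟩, rfl⟩ := hx; exact h d l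
    | zero => simp
    | add x y _ _ hx hy =>
      simp only [ContinuousMap.add_apply]
      rw [integral_add (integrable_C μ x) (integrable_C μ y),
        integral_add (integrable_C ν x) (integrable_C ν y), hx, hy]
    | smul c x _ hx =>
      simp only [ContinuousMap.smul_apply, integral_smul, hx]
  have hC : ∀ f : C(solenoid p, ℂ), ∫ y, f y ∂μ = ∫ y, f y ∂ν := by
    intro f
    by_contra hne
    have hpos : 0 < ‖∫ y, f y ∂μ - ∫ y, f y ∂ν‖ := norm_pos_iff.mpr (sub_ne_zero.mpr hne)
    obtain ⟨g, hg, hfg⟩ := exists_span_near f (half_pos (half_pos hpos))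
    set ε := ‖∫ y, f y ∂μ - ∫ y, f y ∂ν‖
    have key : ∀ (κ : Measure (solenoid p)) [IsProbabilityMeasure κ],
        ‖∫ y, f y ∂κ - ∫ y, g y ∂κ‖ ≤ ε / 2 / 2 := by
      intro κ _
      rw [← integral_sub (integrable_C κ f) (integrable_C κ g)]
      refine (norm_integral_le_of_norm_le_const (ae_of_all _ fun y => (hfg y).le)).trans ?_
      simp
    have h1 := key μ
    have h2 := key ν
    have h3 : ε ≤ ε / 2 / 2 + ε / 2 / 2 := by
      calc ε = ‖(∫ y, f y ∂μ - ∫ y, g y ∂μ) - (∫ y, f y ∂ν - ∫ y, g y ∂ν)‖ := by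
            rw [hs g hg]; simp only [sub_sub_sub_cancel_right]; rfl
        _ ≤ _ := (norm_sub_le _ _).trans (add_le_add h1 h2)
    linarith
  refine ext_of_forall_integral_eq_of_IsFiniteMeasure fun f => ?_
  have h1 := hC ⟨fun y => ((f y : ℝ) : ℂ), by fun_prop⟩
  simp only [ContinuousMap.coe_mk] at h1
  rw [integral_complex_ofReal, integral_complex_ofReal] at h1
  exact_mod_cast h1

/-- Every character of `S_p` is one of the `χ_{d,ℓ}`. -/
theorem exists_eq_char (χ : PontryaginDual (solenoid p)) : ∃ d l, χ = char p d l := by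
  by_contra! hne
  let K : TopologicalSpace.PositiveCompacts (solenoid p) := ⊤
  let μ : Measure (solenoid p) := Measure.haarMeasure K
  have : IsProbabilityMeasure μ := ⟨by
    have := Measure.haarMeasure_self (K₀ := K)
    simpa [K] using this⟩
  have hzero : ∀ d l, ∫ y, ((χ⁻¹ y : Circle) : ℂ) * (char p d l y : ℂ) ∂μ = 0 := by
    intro d l
    obtain ⟨x, hx⟩ : ∃ x, χ x ≠ char p d l x := by
      by_contra! h
      exact hne d l (PontryaginDual.ext h)
    set F : solenoid p → ℂ := fun y => ((χ⁻¹ y : Circle) : ℂ) * (char p d l y : ℂ) with hF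
    have hmul : ∀ y, F (x * y) = F x * F y := by
      intro y
      simp only [hF, map_mul, Circle.coe_mul]
      ring
    have h1 : ∫ y, F (x * y) ∂μ = ∫ y, F y ∂μ := integral_mul_left_eq_self F x
    simp only [hmul] at h1
    rw [integral_const_mul] at h1
    have h2 : F x ≠ 1 := by
      intro h
      apply hx
      have h3 : (χ x)⁻¹ * char p d l x = 1 := by
        apply Circle.ext
        rw [Circle.coe_mul]
        exact h
      exact (inv_mul_eq_one.mp h3)
    have h3 : (F x - 1) * ∫ y, F y ∂μ = 0 := by rw [sub_mul, h1]; ring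
    exact (mul_eq_zero.mp h3).resolve_left (sub_ne_zero.mpr h2)
  have hs : ∀ g ∈ Submodule.span ℂ (Set.range fun q : ℕ × ℤ => toC (char p q.1 q.2)),
      ∫ y, (toC χ⁻¹ * g) y ∂μ = 0 := by
    intro g hg
    induction hg using Submodule.span_induction with
    | mem x hx => obtain ⟨⟨d, l⟩, rfl⟩ := hx; exact hzero d l
    | zero => simp
    | add x y _ _ hx hy =>
      simp only [mul_add, ContinuousMap.add_apply]
      rw [integral_add (integrable_C μ _) (integrable_C μ _), hx, hy, add_zero]
    | smul c x _ hx =>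
      simp only [mul_smul_comm, ContinuousMap.smul_apply, integral_smul, hx, smul_zero]
  obtain ⟨g, hg, hfg⟩ := exists_span_near (toC χ) one_half_pos
  have hone : ∀ y, (toC χ⁻¹ * toC χ) y = 1 := by
    intro y
    show (((χ y)⁻¹ : Circle) : ℂ) * ((χ y : Circle) : ℂ) = 1
    rw [← Circle.coe_mul]; simp
  have h1 : ∫ y, (toC χ⁻¹ * (toC χ - g)) y ∂μ = 1 := by
    simp only [mul_sub, ContinuousMap.sub_apply]
    rw [integral_sub (integrable_C μ _) (integrable_C μ _), hs g hg]
    simp [hone]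
  have h2 : ‖∫ y, (toC χ⁻¹ * (toC χ - g)) y ∂μ‖ ≤ 1 / 2 * μ.real Set.univ := by
    refine norm_integral_le_of_norm_le_const (ae_of_all _ fun y => ?_)
    rw [ContinuousMap.mul_apply, norm_mul, toC_apply, Circle.norm_coe, one_mul]
    exact (hfg y).le
  rw [h1] at h2
  norm_num at h2

/-- The quadratic form `ψ_b` on the character group of `S_p`, `ψ_b(χ_{d,ℓ}) = b ℓ² / p^{2d}`.
Every character is some `χ_{d,ℓ}`, and the value does not depend on the choice of `d` and `ℓ`:
see `psi_char`. -/
def psi (p : ℕ) (b : ℝ≥0) (χ : PontryaginDual (solenoid p)) : ℝ :=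
  b * ((exists_eq_char χ).choose_spec.choose : ℝ) ^ 2 / p ^ (2 * (exists_eq_char χ).choose)

theorem psi_char [Fact p.Prime] (b : ℝ≥0) (d : ℕ) (l : ℤ) :
    psi p b (char p d l) = b * (l : ℝ) ^ 2 / p ^ (2 * d) := by
  have h := freq_unique (exists_eq_char (char p d l)).choose_spec.choose_spec
  rw [psi, mul_div_assoc, mul_div_assoc, mul_comm 2, mul_comm 2, pow_mul, pow_mul, ← div_pow,
    ← div_pow, h]

/-- The defining property of the symmetric Gauss measure `γ_ψ`: its Fourier transform is
`χ ↦ exp (-ψ(χ) / 2)`. -/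
def IsGauss (ψ : PontryaginDual (solenoid p) → ℝ) (γ : ProbabilityMeasure (solenoid p)) : Prop :=
  ∀ χ : PontryaginDual (solenoid p),
    ∫ y, (χ y : ℂ) ∂(γ : Measure (solenoid p)) = (Real.exp (-ψ χ / 2) : ℂ)

theorem exists_isGauss (p : ℕ) [Fact p.Prime] (b : ℝ≥0) :
    ∃ γ : ProbabilityMeasure (solenoid p), IsGauss (psi p b) γ := by
  have hm : Measurable (flow p) := continuous_flow.measurable
  refine ⟨⟨(gaussianReal 0 b).map (flow p), Measure.isProbabilityMeasure_map hm.aemeasurable⟩,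
    fun χ => ?_⟩
  obtain ⟨d, l, rfl⟩ := exists_eq_char χ
  refine (integral_map hm.aemeasurable
    (toC (char p d l)).continuous.aestronglyMeasurable).trans ?_
  rw [psi_char]
  have h := charFun_gaussianReal (μ := 0) (v := b) (l / p ^ d : ℝ)
  rw [charFun_apply_real] at h
  simp only [toC_apply, char_flow, Circle.coe_exp]
  push_cast at h ⊢
  rw [h]
  congr 1
  ring

theorem existsUnique_isGauss (p : ℕ) [Fact p.Prime] (b : ℝ≥0) :
    ∃! γ : ProbabilityMeasure (solenoid p), IsGauss (psi p b) γ := by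
  obtain ⟨γ, hγ⟩ := exists_isGauss p b
  exact ⟨γ, hγ, fun γ' hγ' => Subtype.ext
    (measure_ext (γ' : Measure (solenoid p)) (γ : Measure (solenoid p)) fun d l => (hγ' (char p d l)).trans (hγ (char p d l)).symm)⟩

/-- The symmetric Gauss measure `γ_{ψ_b}` on `S_p`: the unique probability measure whose Fourier
transform is `χ ↦ exp (-ψ_b(χ) / 2)`. -/
def gauss (p : ℕ) [Fact p.Prime] (b : ℝ≥0) : ProbabilityMeasure (solenoid p) :=
  (existsUnique_isGauss p b).choose

theorem isGauss_gauss (p : ℕ) [Fact p.Prime] (b : ℝ≥0) : IsGauss (psi p b) (gauss p b) :=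
  (existsUnique_isGauss p b).choose_spec.1

end solenoid

/-- The argument on the circle with values in `[-π, π)` (Mathlib's `Complex.arg` takes values in
`(-π, π]`). -/
def circleArg (z : Circle) : ℝ :=
  if Complex.arg z = Real.pi then -Real.pi else Complex.arg z

theorem circleArg_exp {x : ℝ} (h₁ : -Real.pi ≤ x) (h₂ : x < Real.pi) :
    circleArg (Circle.exp x) = x := by
  rcases h₁.eq_or_lt with rfl | h
  · have h : Circle.exp (-Real.pi) = Circle.exp Real.pi := by
      rw [Circle.exp_eq_exp]; exact ⟨-1, by push_cast; ring⟩
    rw [circleArg, h, Circle.arg_exp (by linarith [Real.pi_pos]) le_rfl, if_pos rfl]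
  · rw [circleArg, Circle.arg_exp h h₂.le, if_neg h₂.ne]

/-- An array `X_{n,k}`, `1 ≤ k ≤ K_n`, of random elements of a topological group is infinitesimal
if `max_k P(X_{n,k} ∉ U) → 0` for every Borel neighbourhood `U` of the identity (the maximum over
an empty row is `0`). -/
def IsInfinitesimal {G : Type*} [Group G] [TopologicalSpace G] [MeasurableSpace G]
    {Ω : ℕ → Type*} [∀ n, MeasurableSpace (Ω n)] (P : ∀ n, Measure (Ω n)) (K : ℕ → ℕ)
    (X : ∀ n, Fin (K n) → Ω n → G) : Prop :=
  ∀ U : Set G, MeasurableSet U → U ∈ 𝓝 (1 : G) →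
    Tendsto (fun n => ⨆ k : Fin (K n), (P n).real {ω | X n k ω ∉ U}) atTop (𝓝 0)

end

/-!
The characters `χ_{d,ℓ}` span a dense subspace of `C(S_p, ℂ)`, so weak convergence on `S_p` can be
tested on them, and by independence the Fourier transform of a row sum is the product of those of
its terms. If no `arg y_j` with `j ≤ d` exceeds `1 / p` in absolute value, then raising to the
`p`-th power multiplies each of these arguments by `p` without wrapping around the circle; hence
`arg y_0 = p ^ d * arg y_d` and `χ_{d,ℓ}(y) = exp (i (ℓ / p ^ d) arg y_0)`. The exceptional events
have vanishing total probability, so the Fourier transform of the row sum at `χ_{d,ℓ}` is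
asymptotically the product of the characteristic functions of the real variables
`arg (X_{n,k})_0` at `ℓ / p ^ d`. These variables are bounded by `π`, so the tail condition implies
Lindeberg's condition, and the central limit theorem on the real line applies.
-/

theorem norm_prod_sub_prod_le_sum {ι R : Type*} [NormedCommRing R] [NormOneClass R] (s : Finset ι)
    (f g : ι → R) (hf : ∀ i ∈ s, ‖f i‖ ≤ 1) (hg : ∀ i ∈ s, ‖g i‖ ≤ 1) :
    ‖∏ i ∈ s, f i - ∏ i ∈ s, g i‖ ≤ ∑ i ∈ s, ‖f i - g i‖ := by
  classical
  induction s using Finset.induction_on with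
  | empty => simp
  | insert i s hi ih =>
    rw [Finset.forall_mem_insert] at hf hg
    rw [Finset.prod_insert hi, Finset.prod_insert hi, Finset.sum_insert hi]
    have norm_prod_le_one : ‖∏ j ∈ s, f j‖ ≤ 1 :=
      (Finset.norm_prod_le s f).trans (Finset.prod_le_one (fun _ _ => norm_nonneg _) hf.2)
    calc ‖f i * ∏ j ∈ s, f j - g i * ∏ j ∈ s, g j‖
        = ‖(f i - g i) * ∏ j ∈ s, f j + g i * (∏ j ∈ s, f j - ∏ j ∈ s, g j)‖ := by ring_nf
      _ ≤ ‖f i - g i‖ * ‖∏ j ∈ s, f j‖ + ‖g i‖ * ‖∏ j ∈ s, f j - ∏ j ∈ s, g j‖ :=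
          norm_add_le_of_le (norm_mul_le _ _) (norm_mul_le _ _)
      _ ≤ ‖f i - g i‖ * 1 + 1 * ∑ j ∈ s, ‖f j - g j‖ := by
          gcongr
          exacts [hg.1, ih hf.2 hg.2]
      _ = ‖f i - g i‖ + ∑ j ∈ s, ‖f j - g j‖ := by ring

theorem norm_exp_mul_I_sub_taylor_le_cube {x : ℝ} (hx : |x| ≤ 1) :
    ‖Complex.exp (x * Complex.I) - (1 + x * Complex.I - x ^ 2 / 2)‖ ≤ |x| ^ 3 := by
  have norm_eq : ‖(x * Complex.I : ℂ)‖ = |x| := by simp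
  have taylor := Complex.exp_bound (norm_eq.trans_le hx) (n := 3) (by norm_num)
  rw [norm_eq] at taylor
  calc _ = ‖Complex.exp (x * Complex.I)
          - ∑ m ∈ Finset.range 3, (x * Complex.I : ℂ) ^ m / m.factorial‖ := by
        congr 2
        simp only [Finset.sum_range_succ, Finset.range_one, Finset.sum_singleton, mul_pow, pow_zero,
          pow_one, Complex.I_sq, Nat.factorial, Nat.cast_one]
        push_cast
        ring
    _ ≤ |x| ^ 3 * 1 := taylor.trans (by gcongr; norm_num [Nat.factorial])
    _ = |x| ^ 3 := mul_one _

theorem norm_exp_mul_I_sub_taylor_le_sq {x : ℝ} (hx : 1 ≤ |x|) :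
    ‖Complex.exp (x * Complex.I) - (1 + x * Complex.I - x ^ 2 / 2)‖ ≤ 3 * x ^ 2 := by
  have exp_sub_one : ‖Complex.exp (x * Complex.I) - 1‖ ≤ |x| := by
    simpa [mul_comm] using Real.norm_exp_I_mul_ofReal_sub_one_le (x := x)
  have linear : ‖(x * Complex.I : ℂ)‖ = |x| := by simp
  have quadratic : ‖(x ^ 2 / 2 : ℂ)‖ = x ^ 2 / 2 := by simp
  calc _ = ‖(Complex.exp (x * Complex.I) - 1) - x * Complex.I + x ^ 2 / 2‖ := by ring_nf
    _ ≤ |x| + |x| + x ^ 2 / 2 :=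
        norm_add_le_of_le (norm_sub_le_of_le exp_sub_one linear.le) quadratic.le
    _ ≤ 3 * x ^ 2 := by rw [← sq_abs x]; nlinarith

theorem norm_exp_mul_I_sub_taylor_le (x : ℝ) :
    ‖Complex.exp (x * Complex.I) - (1 + x * Complex.I - x ^ 2 / 2)‖ ≤ 3 * (x ^ 2 * min 1 |x|) := by
  rcases le_total |x| 1 with hx | hx
  · calc _ ≤ |x| ^ 3 := norm_exp_mul_I_sub_taylor_le_cube hx
      _ = x ^ 2 * |x| := by rw [← sq_abs x]; ring
      _ ≤ 3 * (x ^ 2 * |x|) := by linarith [mul_nonneg (sq_nonneg x) (abs_nonneg x)]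
      _ = _ := by rw [min_eq_right hx]
  · simpa [min_eq_left hx] using norm_exp_mul_I_sub_taylor_le_sq hx

theorem abs_exp_neg_sub_one_sub_le {x : ℝ} (hx : 0 ≤ x) :
    |Real.exp (-x) - (1 - x)| ≤ x ^ 2 := by
  have lower := Real.one_sub_le_exp_neg x
  rw [abs_of_nonneg (by linarith)]
  rcases le_total x 1 with h | h
  · have := Real.abs_exp_sub_one_sub_id_le (x := -x) (by rwa [abs_neg, abs_of_nonneg hx])
    rw [neg_sq] at this
    linarith [le_abs_self (Real.exp (-x) - 1 - -x)]
  · nlinarith [Real.exp_le_one_iff.mpr (neg_nonpos.mpr hx)]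

section Lindeberg

variable {Ω : Type*} [MeasurableSpace Ω]

/-- The part of the variance of `Y` coming from deviations larger than `ε`, that is, one term of
Lindeberg's sum. -/
noncomputable def tailVariance (Y : Ω → ℝ) (P : Measure Ω) (ε : ℝ) : ℝ :=
  ∫ ω in {ω | ε < |Y ω - P[Y]|}, (Y ω - P[Y]) ^ 2 ∂P

variable {P : Measure Ω} {Y : Ω → ℝ}

theorem tailVariance_nonneg (ε : ℝ) : 0 ≤ tailVariance Y P ε :=
  integral_nonneg fun _ => sq_nonneg _

theorem integrable_sq_sub_integral [IsFiniteMeasure P] (hY : MemLp Y 2 P) :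
    Integrable (fun ω => (Y ω - P[Y]) ^ 2) P :=
  (hY.sub (memLp_const _)).integrable_sq

theorem nullMeasurableSet_lt_abs_sub {c : ℝ} (hY : AEMeasurable Y P) (ε : ℝ) :
    NullMeasurableSet {ω | ε < |Y ω - c|} P :=
  nullMeasurableSet_lt aemeasurable_const (hY.sub_const c).abs

theorem variance_le_sq_add_tailVariance [IsProbabilityMeasure P] (hY : MemLp Y 2 P) (ε : ℝ) :
    Var[Y; P] ≤ ε ^ 2 + tailVariance Y P ε := by
  have tail := nullMeasurableSet_lt_abs_sub (c := P[Y]) hY.1.aemeasurable ε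
  rw [tailVariance, variance_eq_integral hY.1.aemeasurable,
    ← integral_add_compl₀ tail (integrable_sq_sub_integral hY), add_comm]
  gcongr
  calc _ ≤ ∫ ω in {ω | ε < |Y ω - P[Y]|}ᶜ, ε ^ 2 ∂P := by
        refine setIntegral_mono_on₀ (integrable_sq_sub_integral hY).integrableOn
          integrableOn_const tail.compl fun ω hω => ?_
        have deviation_le : |Y ω - P[Y]| ≤ ε := not_lt.mp hω
        exact sq_le_sq' (abs_le.mp deviation_le).1 (abs_le.mp deviation_le).2
    _ ≤ ε ^ 2 := by
        rw [setIntegral_const, smul_eq_mul]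
        exact mul_le_of_le_one_left (sq_nonneg _) measureReal_le_one

theorem sq_mul_min_one_abs_le {ε : ℝ} (hε : 0 ≤ ε) (t z : ℝ) :
    (t * z) ^ 2 * min 1 |t * z|
      ≤ t ^ 2 * (|t| * ε * z ^ 2 + {z : ℝ | ε < |z|}.indicator (· ^ 2) z) := by
  rw [mul_pow, mul_assoc]
  gcongr
  by_cases hz : ε < |z|
  · rw [Set.indicator_of_mem (by exact hz)]
    have := mul_le_mul_of_nonneg_left (min_le_left 1 |t * z|) (sq_nonneg z)
    have : 0 ≤ |t| * ε * z ^ 2 := by positivity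
    linarith
  · rw [Set.indicator_of_notMem (by exact hz), add_zero, mul_comm]
    gcongr
    exact (min_le_right _ _).trans (by rw [abs_mul]; gcongr; exact not_lt.mp hz)

theorem norm_charFun_map_sub_taylor_le [IsProbabilityMeasure P] (hY : MemLp Y 2 P) (t : ℝ) :
    ‖charFun (P.map Y) t - (1 + t * (P[Y] : ℝ) * Complex.I - t ^ 2 / 2 * (P[Y ^ 2] : ℝ))‖
      ≤ ∫ ω, 3 * ((t * Y ω) ^ 2 * min 1 |t * Y ω|) ∂P := by
  have integrable_tY : Integrable (fun ω => t * Y ω) P :=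
    (hY.integrable one_le_two).const_mul t
  have integrable_tY_sq : Integrable (fun ω => (t * Y ω) ^ 2) P := (hY.const_mul t).integrable_sq
  have integrable_linear : Integrable (fun ω => (1 + (t * Y ω : ℝ) * Complex.I : ℂ)) P :=
    (integrable_const _).add (integrable_tY.ofReal.mul_const _)
  have integrable_quadratic : Integrable (fun ω => (((t * Y ω) ^ 2 : ℝ) / 2 : ℂ)) P :=
    integrable_tY_sq.ofReal.div_const 2
  have integral_taylor :
      ∫ ω, (1 + (t * Y ω : ℝ) * Complex.I - ((t * Y ω) ^ 2 : ℝ) / 2 : ℂ) ∂P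
        = 1 + t * (P[Y] : ℝ) * Complex.I - t ^ 2 / 2 * (P[Y ^ 2] : ℝ) := by
    rw [integral_sub integrable_linear integrable_quadratic,
      integral_add (integrable_const _) (integrable_tY.ofReal.mul_const _), integral_mul_const,
      integral_div, integral_complex_ofReal, integral_complex_ofReal]
    simp only [mul_pow, integral_const, integral_const_mul, probReal_univ, one_smul, Pi.pow_apply,
      Complex.ofReal_mul, Complex.ofReal_pow]
    ring
  have integrable_exp : Integrable (fun ω => Complex.exp ((t * Y ω : ℝ) * Complex.I)) P := by
    refine Integrable.of_bound ?_ 1 (ae_of_all _ fun ω => (Complex.norm_exp_ofReal_mul_I _).le)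
    have := hY.1
    fun_prop
  have integrable_bound : Integrable (fun ω => 3 * ((t * Y ω) ^ 2 * min 1 |t * Y ω|)) P := by
    have := hY.1
    refine (integrable_tY_sq.mono' (by fun_prop) (ae_of_all _ fun ω => ?_)).const_mul 3
    rw [Real.norm_of_nonneg (by positivity)]
    exact mul_le_of_le_one_right (sq_nonneg _) (min_le_left _ _)
  rw [charFun_apply_real, integral_map hY.1.aemeasurable (by fun_prop), ← integral_taylor]
  simp_rw [← Complex.ofReal_mul]
  refine (congrArg norm (integral_sub integrable_exp
    (integrable_linear.sub integrable_quadratic)).symm).trans_le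
    (norm_integral_le_of_norm_le integrable_bound (ae_of_all _ fun ω => ?_))
  exact_mod_cast norm_exp_mul_I_sub_taylor_le (t * Y ω)

theorem norm_charFun_centered_sub_le [IsProbabilityMeasure P] (hY : MemLp Y 2 P) {ε : ℝ}
    (hε : 0 ≤ ε) (t : ℝ) :
    ‖charFun (P.map fun ω => Y ω - P[Y]) t - (1 - t ^ 2 / 2 * Var[Y; P] : ℝ)‖
      ≤ 3 * (t ^ 2 * (|t| * ε * Var[Y; P] + tailVariance Y P ε)) := by
  set Z : Ω → ℝ := fun ω => Y ω - P[Y]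
  have hZ : MemLp Z 2 P := hY.sub (memLp_const _)
  have integral_Z : P[Z] = 0 := by
    simp [Z, integral_sub (hY.integrable one_le_two) (integrable_const _)]
  have integral_Z_sq : P[Z ^ 2] = Var[Y; P] := (variance_eq_integral hY.1.aemeasurable).symm
  have tail := nullMeasurableSet_lt_abs_sub (c := P[Y]) hY.1.aemeasurable ε
  have integrable_tail : Integrable ({ω | ε < |Z ω|}.indicator fun ω => Z ω ^ 2) P :=
    hZ.integrable_sq.indicator₀ tail
  have taylor := norm_charFun_map_sub_taylor_le hZ t
  rw [integral_Z, integral_Z_sq] at taylor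
  calc _ = ‖charFun (P.map Z) t - (1 + t * (0 : ℝ) * Complex.I - t ^ 2 / 2 * Var[Y; P])‖ := by
        simp
    _ ≤ ∫ ω, 3 * ((t * Z ω) ^ 2 * min 1 |t * Z ω|) ∂P := taylor
    _ ≤ ∫ ω, 3 * (t ^ 2 * (|t| * ε * Z ω ^ 2
          + {ω | ε < |Z ω|}.indicator (fun ω => Z ω ^ 2) ω)) ∂P :=
        integral_mono_of_nonneg (ae_of_all _ fun ω => by positivity)
          (((hZ.integrable_sq.const_mul _).add integrable_tail).const_mul _ |>.const_mul _)
          (ae_of_all _ fun ω =>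
            mul_le_mul_of_nonneg_left (sq_mul_min_one_abs_le hε t (Z ω)) zero_le_three)
    _ = 3 * (t ^ 2 * (|t| * ε * P[Z ^ 2] + tailVariance Y P ε)) := by
        rw [integral_const_mul, integral_const_mul,
          integral_add (hZ.integrable_sq.const_mul _) integrable_tail, integral_const_mul,
          integral_indicator₀ tail]
        rfl
    _ = _ := by rw [integral_Z_sq]

theorem norm_charFun_centered_sub_exp_le [IsProbabilityMeasure P] (hY : MemLp Y 2 P) {ε : ℝ}
    (hε : 0 ≤ ε) (t : ℝ) :
    ‖charFun (P.map fun ω => Y ω - P[Y]) t - (Real.exp (-(t ^ 2 / 2 * Var[Y; P])) : ℝ)‖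
      ≤ 3 * (t ^ 2 * (|t| * ε * Var[Y; P] + tailVariance Y P ε))
        + t ^ 4 / 4 * (ε ^ 2 + tailVariance Y P ε) * Var[Y; P] := by
  have variance_nonneg := variance_nonneg Y P
  have exp_error : ‖((1 - t ^ 2 / 2 * Var[Y; P] : ℝ) : ℂ) - Real.exp (-(t ^ 2 / 2 * Var[Y; P]))‖
      ≤ t ^ 4 / 4 * (ε ^ 2 + tailVariance Y P ε) * Var[Y; P] := by
    rw [← Complex.ofReal_sub, Complex.norm_real, Real.norm_eq_abs, abs_sub_comm]
    calc _ ≤ (t ^ 2 / 2 * Var[Y; P]) ^ 2 := abs_exp_neg_sub_one_sub_le (by positivity)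
      _ = t ^ 4 / 4 * Var[Y; P] * Var[Y; P] := by ring
      _ ≤ _ := by
        gcongr
        exact variance_le_sq_add_tailVariance hY ε
  exact (norm_sub_le_norm_sub_add_norm_sub _ _ _).trans
    (add_le_add (norm_charFun_centered_sub_le hY hε t) exp_error)

theorem charFun_map_eq_exp_mul_charFun_map_sub_const (hY : AEMeasurable Y P) (c t : ℝ) :
    charFun (P.map Y) t = Complex.exp (t * c * Complex.I) * charFun (P.map fun ω => Y ω - c) t := by
  have map_eq : P.map Y = (P.map fun ω => Y ω - c).map (· + c) := by
    rw [AEMeasurable.map_map_of_aemeasurable (by fun_prop) (hY.sub_const c)]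
    simp [Function.comp_def]
  rw [map_eq, charFun_map_add_const, mul_comm]
  simp

theorem norm_prod_charFun_centered_sub_exp_le {κ : Type*} [Fintype κ]
    [IsProbabilityMeasure P] {Y : κ → Ω → ℝ} (hY : ∀ k, MemLp (Y k) 2 P) {ε : ℝ}
    (hε : 0 ≤ ε) (t : ℝ) :
    ‖∏ k, charFun (P.map fun ω => Y k ω - P[Y k]) t
        - (Real.exp (-(t ^ 2 / 2 * ∑ k, Var[Y k; P])) : ℝ)‖
      ≤ 3 * (t ^ 2 * (|t| * ε * ∑ k, Var[Y k; P] + ∑ k, tailVariance (Y k) P ε))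
        + t ^ 4 / 4 * (ε ^ 2 + ∑ k, tailVariance (Y k) P ε) * ∑ k, Var[Y k; P] := by
  have isProbabilityMeasure_map (k : κ) : IsProbabilityMeasure (P.map fun ω => Y k ω - P[Y k]) :=
    Measure.isProbabilityMeasure_map ((hY k).1.aemeasurable.sub_const _)
  have exp_eq_prod : Real.exp (-(t ^ 2 / 2 * ∑ k, Var[Y k; P]))
      = ∏ k, Real.exp (-(t ^ 2 / 2 * Var[Y k; P])) := by
    rw [← Real.exp_sum, Finset.sum_neg_distrib, Finset.mul_sum]
  rw [exp_eq_prod, Complex.ofReal_prod]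
  refine (norm_prod_sub_prod_le_sum _ _ _ (fun k _ => norm_charFun_le_one _) fun k _ => ?_).trans ?_
  · rw [Complex.norm_real, Real.norm_eq_abs, Real.abs_exp, Real.exp_le_one_iff, neg_nonpos]
    exact mul_nonneg (by positivity) (variance_nonneg _ _)
  calc _ ≤ ∑ k, (3 * (t ^ 2 * (|t| * ε * Var[Y k; P] + tailVariance (Y k) P ε))
        + t ^ 4 / 4 * (ε ^ 2 + ∑ j, tailVariance (Y j) P ε) * Var[Y k; P]) := by
        gcongr with k
        refine (norm_charFun_centered_sub_exp_le (hY k) hε t).trans ?_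
        gcongr
        · exact variance_nonneg _ _
        · exact Finset.single_le_sum (fun j _ => tailVariance_nonneg ε) (Finset.mem_univ k)
    _ = _ := by
        simp only [Finset.sum_add_distrib, ← Finset.mul_sum]

theorem abs_integral_le_add_mul_measureReal [IsProbabilityMeasure P] (hY : AEMeasurable Y P)
    {B : ℝ} (hB : ∀ ω, |Y ω| ≤ B) {ε : ℝ} (hε : 0 ≤ ε) :
    |P[Y]| ≤ ε + B * P.real {ω | ε < |Y ω|} := by
  have tail : NullMeasurableSet {ω | ε < |Y ω|} P := nullMeasurableSet_lt aemeasurable_const hY.abs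
  have integrable_tail : Integrable ({ω | ε < |Y ω|}.indicator fun _ => B) P :=
    (integrable_const B).indicator₀ tail
  calc |P[Y]| ≤ ∫ ω, ε + {ω | ε < |Y ω|}.indicator (fun _ => B) ω ∂P := by
        refine norm_integral_le_of_norm_le (f := Y) ((integrable_const ε).add integrable_tail)
          (ae_of_all _ fun ω => ?_)
        by_cases hω : ε < |Y ω|
        · rw [Set.indicator_of_mem (by exact hω)]
          exact (hB ω).trans (le_add_of_nonneg_left hε)
        · rw [Set.indicator_of_notMem (by exact hω), add_zero]
          exact not_lt.mp hω
    _ = ε + B * P.real {ω | ε < |Y ω|} := by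
        rw [integral_add (integrable_const ε) integrable_tail, integral_indicator₀ tail]
        simp [mul_comm]

theorem tailVariance_le_of_abs_integral_le [IsProbabilityMeasure P] {B : ℝ}
    (hB : ∀ ω, |Y ω| ≤ B) {ε : ℝ} (hmean : |P[Y]| ≤ ε / 2) :
    tailVariance Y P ε ≤ (2 * B) ^ 2 * P.real {ω | ε / 2 < |Y ω|} := by
  have abs_integral_le : |P[Y]| ≤ B := by
    simpa using norm_integral_le_of_norm_le_const (f := Y) (ae_of_all P hB)
  have subset : {ω | ε < |Y ω - P[Y]|} ⊆ {ω | ε / 2 < |Y ω|} := fun ω (hω : ε < |Y ω - P[Y]|) =>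
    show ε / 2 < |Y ω| by linarith [abs_sub (Y ω) P[Y]]
  calc tailVariance Y P ε ≤ ‖tailVariance Y P ε‖ := le_abs_self _
    _ ≤ (2 * B) ^ 2 * P.real {ω | ε < |Y ω - P[Y]|} := by
        refine norm_setIntegral_le_of_norm_le_const (measure_lt_top _ _) fun ω _ => ?_
        rw [norm_pow]
        gcongr
        exact (abs_sub _ _).trans (by linarith [hB ω])
    _ ≤ _ := by gcongr; exact measure_ne_top _ _

section Array

variable {ι : Type*} {l : Filter ι} {κ : ι → Type*} [∀ n, Fintype (κ n)] {Ω : ι → Type*}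
  [∀ n, MeasurableSpace (Ω n)] {P : ∀ n, Measure (Ω n)} [∀ n, IsProbabilityMeasure (P n)]
  {Y : ∀ n, κ n → Ω n → ℝ}

theorem tendsto_prod_charFun_centered (hY : ∀ n k, MemLp (Y n k) 2 (P n)) {b : ℝ≥0}
    (hvar : Tendsto (fun n => ∑ k, Var[Y n k; P n]) l (𝓝 b))
    (hlindeberg : ∀ ε > 0, Tendsto (fun n => ∑ k, tailVariance (Y n k) (P n) ε) l (𝓝 0)) (t : ℝ) :
    Tendsto (fun n => ∏ k, charFun ((P n).map fun ω => Y n k ω - (P n)[Y n k]) t) l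
      (𝓝 (charFun (gaussianReal 0 b) t)) := by
  have tendsto_exp : Tendsto
      (fun n => ((Real.exp (-(t ^ 2 / 2 * ∑ k, Var[Y n k; P n])) : ℝ) : ℂ)) l
      (𝓝 (charFun (gaussianReal 0 b) t)) := by
    have charFun_eq : charFun (gaussianReal 0 b) t = (Real.exp (-(t ^ 2 / 2 * b)) : ℝ) := by
      rw [charFun_gaussianReal]
      push_cast
      ring_nf
    rw [charFun_eq]
    exact (Complex.continuous_ofReal.tendsto _).comp
      ((Real.continuous_exp.tendsto _).comp (hvar.const_mul _).neg)
  suffices h : Tendsto (fun n => ∏ k, charFun ((P n).map fun ω => Y n k ω - (P n)[Y n k]) t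
      - (Real.exp (-(t ^ 2 / 2 * ∑ k, Var[Y n k; P n])) : ℝ)) l (𝓝 0) by
    simpa using h.add tendsto_exp
  rw [Metric.tendsto_nhds]
  intro δ hδ
  have bound_tendsto (ε : ℝ) (hε : 0 < ε) :=
    ((((hvar.const_mul (|t| * ε)).add (hlindeberg ε hε)).const_mul (t ^ 2)).const_mul 3).add
      ((((hlindeberg ε hε).const_add (ε ^ 2)).const_mul (t ^ 4 / 4)).mul hvar)
  have limit_small : Tendsto (fun ε : ℝ => 3 * (t ^ 2 * (|t| * ε * b + 0))
      + t ^ 4 / 4 * (ε ^ 2 + 0) * b) (𝓝[>] 0) (𝓝 0) :=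
    (Continuous.tendsto' (by fun_prop) _ _ (by simp)).mono_left nhdsWithin_le_nhds
  obtain ⟨ε, limit_lt, hε⟩ :=
    ((limit_small.eventually_lt_const hδ).and self_mem_nhdsWithin).exists
  filter_upwards [(bound_tendsto ε hε).eventually_lt_const limit_lt] with n hn
  rw [dist_zero_right]
  exact (norm_prod_charFun_centered_sub_exp_le (hY n) (le_of_lt hε) t).trans_lt hn

theorem tendsto_prod_charFun (hY : ∀ n k, MemLp (Y n k) 2 (P n)) {b : ℝ≥0} {t : ℝ} {z : ℂ}
    (hmean : Tendsto (fun n => Complex.exp (t * (∑ k, (P n)[Y n k] : ℝ) * Complex.I)) l (𝓝 z))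
    (hvar : Tendsto (fun n => ∑ k, Var[Y n k; P n]) l (𝓝 b))
    (hlindeberg : ∀ ε > 0, Tendsto (fun n => ∑ k, tailVariance (Y n k) (P n) ε) l (𝓝 0)) :
    Tendsto (fun n => ∏ k, charFun ((P n).map (Y n k)) t) l
      (𝓝 (z * charFun (gaussianReal 0 b) t)) := by
  refine (hmean.mul (tendsto_prod_charFun_centered hY hvar hlindeberg t)).congr fun n => ?_
  rw [Finset.prod_congr rfl fun k _ => charFun_map_eq_exp_mul_charFun_map_sub_const
    (hY n k).1.aemeasurable ((P n)[Y n k]) t, Finset.prod_mul_distrib, ← Complex.exp_sum]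
  push_cast
  rw [Finset.mul_sum, Finset.sum_mul]

theorem tendsto_sum_tailVariance_of_bounded (hY : ∀ n k, AEMeasurable (Y n k) (P n)) {B : ℝ}
    (hB : ∀ n k ω, |Y n k ω| ≤ B)
    (htail : ∀ ε > 0, Tendsto (fun n => ∑ k, (P n).real {ω | ε < |Y n k ω|}) l (𝓝 0)) {ε : ℝ}
    (hε : 0 < ε) : Tendsto (fun n => ∑ k, tailVariance (Y n k) (P n) ε) l (𝓝 0) := by
  have mean_small : ∀ᶠ n in l, ∀ k, |(P n)[Y n k]| ≤ ε / 2 := by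
    have small : ∀ᶠ n in l, |B| * ∑ k, (P n).real {ω | ε / 4 < |Y n k ω|} < ε / 4 :=
      ((htail (ε / 4) (by positivity)).const_mul |B|).eventually_lt_const (by simpa using hε)
    filter_upwards [small] with n hn k
    have mean_le := abs_integral_le_add_mul_measureReal (hY n k)
      (fun ω => (hB n k ω).trans (le_abs_self B)) (by positivity : 0 ≤ ε / 4)
    have term_le := mul_le_mul_of_nonneg_left (Finset.single_le_sum
      (fun k _ => measureReal_nonneg (μ := P n) (s := {ω | ε / 4 < |Y n k ω|}))
      (Finset.mem_univ k)) (abs_nonneg B)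
    linarith
  refine squeeze_zero' (.of_forall fun n => Finset.sum_nonneg fun k _ => tailVariance_nonneg ε) ?_
    (by simpa using (htail (ε / 2) (by positivity)).const_mul ((2 * B) ^ 2))
  filter_upwards [mean_small] with n hn
  rw [Finset.mul_sum]
  exact Finset.sum_le_sum fun k _ => tailVariance_le_of_abs_integral_le (hB n k) (hn k)

end Array

end Lindeberg

theorem norm_integral_sub_integral_le {Ω E : Type*} [MeasurableSpace Ω] [NormedAddCommGroup E]
    [NormedSpace ℝ E] {μ : Measure Ω} {f g : Ω → E} (hf : Integrable f μ) (hg : Integrable g μ)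
    {C : ℝ} (hfC : ∀ ω, ‖f ω‖ ≤ C) (hgC : ∀ ω, ‖g ω‖ ≤ C) {A : Set Ω} (hA : μ A < ⊤)
    (hfg : ∀ ω ∉ A, f ω = g ω) : ‖∫ ω, f ω ∂μ - ∫ ω, g ω ∂μ‖ ≤ 2 * C * μ.real A := by
  rw [← integral_sub hf hg, ← setIntegral_eq_integral_of_forall_compl_eq_zero
    fun ω hω => sub_eq_zero.mpr (hfg ω hω)]
  refine norm_setIntegral_le_of_norm_le_const hA fun ω _ => ?_
  rw [two_mul]
  exact norm_sub_le_of_le (hfC ω) (hgC ω)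

theorem integral_character_map_prod {Ω κ G : Type*} [MeasurableSpace Ω] {P : Measure Ω} [Fintype κ]
    [CommGroup G] [TopologicalSpace G] [MeasurableSpace G] [OpensMeasurableSpace G]
    [MeasurableMul₂ G] {X : κ → Ω → G} (hX : ∀ k, AEMeasurable (X k) P) (hindep : iIndepFun X P)
    (χ : PontryaginDual G) :
    ∫ y, (χ y : ℂ) ∂(P.map fun ω => ∏ k, X k ω) = ∏ k, ∫ ω, (χ (X k ω) : ℂ) ∂P := by
  have continuous_χ : Continuous fun y => (χ y : ℂ) :=
    continuous_subtype_val.comp χ.continuous_toFun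
  rw [integral_map (Finset.aemeasurable_fun_prod _ fun k _ => hX k)
      continuous_χ.aestronglyMeasurable,
    ← hindep.integral_fun_prod_comp hX (f := fun _ y => (χ y : ℂ))
      fun k => continuous_χ.aestronglyMeasurable]
  simp only [map_prod]
  exact integral_congr_ae (ae_of_all _ fun ω => map_prod Circle.coeHom _ _)

theorem isInfinitesimal_of_tendsto_sum_measureReal_notMem {G : Type*} [Group G]
    [TopologicalSpace G] [MeasurableSpace G] {Ω : ℕ → Type*} [∀ n, MeasurableSpace (Ω n)]
    {P : ∀ n, Measure (Ω n)} {K : ℕ → ℕ} {X : ∀ n, Fin (K n) → Ω n → G}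
    (h : ∀ U ∈ 𝓝 (1 : G), Tendsto (fun n => ∑ k, (P n).real {ω | X n k ω ∉ U}) atTop (𝓝 0)) :
    IsInfinitesimal P K X := by
  intro U _ hU
  refine squeeze_zero (fun n => Real.iSup_nonneg fun k => measureReal_nonneg)
    (fun n => Real.iSup_le (fun k => ?_) ?_) (h U hU)
  · exact Finset.single_le_sum (f := fun k => (P n).real {ω | X n k ω ∉ U})
      (fun _ _ => measureReal_nonneg) (Finset.mem_univ k)
  · exact Finset.sum_nonneg fun _ _ => measureReal_nonneg

section DenseSpan

variable {X 𝕜 : Type*} [TopologicalSpace X] [CompactSpace X] [MeasurableSpace X]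
  [OpensMeasurableSpace X] [RCLike 𝕜]

theorem integrable_continuousMap (μ : Measure X) [IsFiniteMeasure μ] (f : C(X, 𝕜)) :
    Integrable f μ :=
  (BoundedContinuousFunction.mkOfCompact f).integrable μ

theorem lipschitzWith_integral (μ : Measure X) [IsProbabilityMeasure μ] :
    LipschitzWith 1 fun f : C(X, 𝕜) => ∫ x, f x ∂μ := by
  refine LipschitzWith.of_dist_le_mul fun f g => ?_
  rw [dist_eq_norm, ← integral_sub (integrable_continuousMap μ f) (integrable_continuousMap μ g)]
  refine (norm_integral_le_of_norm_le_const
    (ae_of_all μ fun x => (dist_eq_norm (f x) (g x)).ge.trans (f.dist_apply_le_dist x))).trans_eq ?_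
  simp [mul_comm]

theorem tendsto_integral_of_mem_span {ι : Type*} {l : Filter ι} {μ : ι → Measure X}
    [∀ i, IsFiniteMeasure (μ i)] {ν : Measure X} [IsFiniteMeasure ν]
    {S : Set C(X, 𝕜)} (h : ∀ f ∈ S, Tendsto (fun i => ∫ x, f x ∂(μ i)) l (𝓝 (∫ x, f x ∂ν)))
    {f : C(X, 𝕜)} (hf : f ∈ Submodule.span 𝕜 S) :
    Tendsto (fun i => ∫ x, f x ∂(μ i)) l (𝓝 (∫ x, f x ∂ν)) := by
  induction hf using Submodule.span_induction with
  | mem f hf => exact h f hf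
  | zero => simpa using tendsto_const_nhds
  | add f g _ _ hf hg =>
    simpa only [ContinuousMap.add_apply, integral_add (integrable_continuousMap _ f)
      (integrable_continuousMap _ g)] using hf.add hg
  | smul c f _ hf =>
    simpa only [ContinuousMap.smul_apply, integral_smul] using hf.const_smul c

theorem tendsto_probabilityMeasure_of_dense_span {ι : Type*} {l : Filter ι}
    {μ : ι → ProbabilityMeasure X} {ν : ProbabilityMeasure X} {S : Set C(X, 𝕜)}
    (hS : Dense (Submodule.span 𝕜 S : Set C(X, 𝕜)))
    (h : ∀ f ∈ S,
      Tendsto (fun i => ∫ x, f x ∂(μ i : Measure X)) l (𝓝 (∫ x, f x ∂(ν : Measure X)))) :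
    Tendsto μ l (𝓝 ν) := by
  have equicontinuous : Equicontinuous fun i (f : C(X, 𝕜)) => ∫ x, f x ∂(μ i : Measure X) :=
    (LipschitzWith.uniformEquicontinuous _ 1 fun i => lipschitzWith_integral _).equicontinuous
  have tendsto_integral (f : C(X, 𝕜)) :=
    (equicontinuous.isClosed_setOfPred_tendsto (l := l)
      (lipschitzWith_integral (ν : Measure X)).continuous).closure_subset_iff.mpr
        (fun f hf => tendsto_integral_of_mem_span h hf) (hS f)
  exact (ProbabilityMeasure.tendsto_iff_forall_integral_rclike_tendsto 𝕜).mpr fun f =>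
    tendsto_integral f.toContinuousMap

end DenseSpan

section CircleArg

theorem circleExp_circleArg (z : Circle) : Circle.exp (circleArg z) = z := by
  unfold circleArg
  split_ifs with arg_eq_pi
  · rw [← Circle.exp_add_two_pi, show -Real.pi + 2 * Real.pi = Real.pi by ring, ← arg_eq_pi,
      Circle.exp_arg]
  · exact Circle.exp_arg z

theorem abs_circleArg_le_pi (z : Circle) : |circleArg z| ≤ Real.pi := by
  unfold circleArg
  split_ifs
  · rw [abs_neg, abs_of_pos Real.pi_pos]
  · exact Complex.abs_arg_le_pi z

theorem circleArg_pow {n : ℕ} {z : Circle} (h : n * |circleArg z| < Real.pi) :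
    circleArg (z ^ n) = n * circleArg z := by
  have abs_lt_pi : |n * circleArg z| < Real.pi := by rwa [abs_mul, Nat.abs_cast]
  rw [← circleArg_exp (abs_lt.mp abs_lt_pi).1.le (abs_lt.mp abs_lt_pi).2, ← nsmul_eq_mul,
    Circle.exp_nsmul, circleExp_circleArg]

theorem measurable_circleArg_comp {α : Type*} [MeasurableSpace α] {f : α → Circle}
    (hf : Measurable fun x => (f x : ℂ)) : Measurable fun x => circleArg (f x) :=
  have arg_comp := Complex.measurable_arg.comp hf
  Measurable.ite (arg_comp (measurableSet_singleton _)) measurable_const arg_comp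

theorem exists_forall_abs_circleArg_le_imp_mem {s : Set Circle} (hs : s ∈ 𝓝 1) :
    ∃ ε > 0, ∀ z, |circleArg z| ≤ ε → z ∈ s := by
  have preimage_mem : Circle.exp ⁻¹' s ∈ 𝓝 0 :=
    Circle.exp.continuous.continuousAt (by rwa [Circle.exp_zero])
  obtain ⟨ε, hε, ball_subset⟩ := Metric.nhds_basis_closedBall.mem_iff.mp preimage_mem
  refine ⟨ε, hε, fun z hz => ?_⟩
  rw [← circleExp_circleArg z]
  exact ball_subset (mem_closedBall_zero_iff.mpr hz)

end CircleArg

namespace solenoid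

variable {p d : ℕ} {ε : ℝ} {y : solenoid p}

/-- The points of `S_p` having some coordinate `y_j`, `j ≤ d`, with argument larger than `ε` in
absolute value. The complements of these sets form a neighbourhood basis of the identity. -/
def largeArgSet (p d : ℕ) (ε : ℝ) : Set (solenoid p) :=
  {y | ∃ j ≤ d, ε < |circleArg (y.1 j)|}

theorem notMem_largeArgSet : y ∉ largeArgSet p d ε ↔ ∀ j ≤ d, |circleArg (y.1 j)| ≤ ε := by
  simp [largeArgSet]

theorem measurable_circleArg_coord (j : ℕ) : Measurable fun y : solenoid p => circleArg (y.1 j) :=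
  measurable_circleArg_comp (Continuous.measurable (continuous_subtype_val.comp
    ((continuous_apply j).comp continuous_subtype_val)))

theorem exists_compl_largeArgSet_subset {U : Set (solenoid p)} (hU : U ∈ 𝓝 1) :
    ∃ d, ∃ ε > 0, (largeArgSet p d ε)ᶜ ⊆ U := by
  obtain ⟨V, hV, hVU⟩ := (mem_nhds_subtype _ _ _).mp hU
  rw [nhds_pi, Filter.mem_pi] at hV
  obtain ⟨I, I_finite, s, hs, pi_subset⟩ := hV
  choose δ δ_pos mem_of_abs_le using fun j => exists_forall_abs_circleArg_le_imp_mem (hs j)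
  obtain ⟨d, hd⟩ := I_finite.bddAbove
  refine ⟨d, (Finset.Iic d).inf' Finset.nonempty_Iic δ,
    (Finset.lt_inf'_iff _).mpr fun j _ => δ_pos j,
    fun y hy => hVU (pi_subset fun j hj => mem_of_abs_le j _ ?_)⟩
  exact (notMem_largeArgSet.mp hy j (hd hj)).trans (Finset.inf'_le _ (Finset.mem_Iic.mpr (hd hj)))

theorem circleArg_coord_zero (hε : p * ε < Real.pi) (hy : y ∉ largeArgSet p d ε) :
    circleArg (y.1 0) = p ^ d * circleArg (y.1 d) := by
  rw [notMem_largeArgSet] at hy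
  induction d with
  | zero => simp
  | succ d ih =>
    have mul_abs_lt : p * |circleArg (y.1 (d + 1))| < Real.pi :=
      (mul_le_mul_of_nonneg_left (hy (d + 1) le_rfl) p.cast_nonneg).trans_lt hε
    rw [ih fun j hj => hy j (hj.trans d.le_succ), y.2 d, circleArg_pow mul_abs_lt]
    ring

theorem char_eq_exp_circleArg_coord_zero [NeZero p] (hε : p * ε < Real.pi)
    (hy : y ∉ largeArgSet p d ε) (m : ℤ) :
    (char p d m y : ℂ) = Complex.exp ((m / p ^ d : ℝ) * circleArg (y.1 0) * Complex.I) := by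
  have hp : (p : ℝ) ≠ 0 := NeZero.ne _
  rw [← Complex.ofReal_mul, ← Circle.coe_exp, circleArg_coord_zero hε hy, ← mul_assoc,
    div_mul_cancel₀ _ (pow_ne_zero d hp), ← zsmul_eq_mul, Circle.exp_zsmul, circleExp_circleArg,
    char_apply]

theorem norm_integral_char_sub_charFun_le [NeZero p] {Ω : Type*} [MeasurableSpace Ω]
    {P : Measure Ω} [IsFiniteMeasure P] {X : Ω → solenoid p} (hX : Measurable X)
    (hε : p * ε < Real.pi) (m : ℤ) :
    ‖∫ ω, (char p d m (X ω) : ℂ) ∂P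
        - charFun (P.map fun ω => circleArg ((X ω).1 0)) (m / p ^ d)‖
      ≤ 2 * P.real (X ⁻¹' largeArgSet p d ε) := by
  have measurable_arg : Measurable fun ω => circleArg ((X ω).1 0) :=
    (measurable_circleArg_coord 0).comp hX
  have integrable_char : Integrable (fun ω => (char p d m (X ω) : ℂ)) P :=
    Integrable.of_bound ((toC (char p d m)).continuous.measurable.comp hX).aestronglyMeasurable 1
      (ae_of_all _ fun ω => (Circle.norm_coe _).le)
  have norm_exp_le (ω : Ω) :
      ‖Complex.exp ((m / p ^ d : ℝ) * circleArg ((X ω).1 0) * Complex.I)‖ ≤ 1 := by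
    rw [← Complex.ofReal_mul, Complex.norm_exp_ofReal_mul_I]
  have continuous_exp :
      Continuous fun x : ℝ => Complex.exp ((m / p ^ d : ℝ) * x * Complex.I) := by
    fun_prop
  rw [charFun_apply_real, integral_map measurable_arg.aemeasurable (by fun_prop),
    ← mul_one (2 : ℝ)]
  exact norm_integral_sub_integral_le integrable_char
    (Integrable.of_bound (continuous_exp.comp_aestronglyMeasurable
      measurable_arg.aestronglyMeasurable) 1 (ae_of_all _ norm_exp_le))
    (fun ω => (Circle.norm_coe _).le) norm_exp_le (measure_lt_top _ _) fun ω hω =>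
      char_eq_exp_circleArg_coord_zero hε hω m

theorem integral_char_dirac_mconv_gauss [Fact p.Prime] (a : solenoid p) (b : ℝ≥0) (d : ℕ) (m : ℤ) :
    ∫ y, (char p d m y : ℂ) ∂(Measure.dirac a ∗ₘ (gauss p b : Measure (solenoid p)))
      = (a.1 d : ℂ) ^ m * charFun (gaussianReal 0 b) (m / p ^ d) := by
  have charFun_eq : charFun (gaussianReal 0 b) (m / p ^ d)
      = ∫ y, (char p d m y : ℂ) ∂(gauss p b : Measure (solenoid p)) := by
    rw [isGauss_gauss p b (char p d m), psi_char, charFun_gaussianReal]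
    push_cast
    ring_nf
  refine (integral_mconv (integrable_C _ (toC (char p d m)))).trans ?_
  rw [integral_dirac, charFun_eq]
  simp only [toC_apply, map_mul, Circle.coe_mul, integral_const_mul, char_apply, Circle.coe_zpow]

theorem tendsto_of_tendsto_integral_char {ι : Type*} {l : Filter ι}
    {μ : ι → ProbabilityMeasure (solenoid p)} {ν : ProbabilityMeasure (solenoid p)}
    (h : ∀ d m, Tendsto (fun n => ∫ y, (char p d m y : ℂ) ∂(μ n : Measure (solenoid p))) l
      (𝓝 (∫ y, (char p d m y : ℂ) ∂(ν : Measure (solenoid p))))) :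
    Tendsto μ l (𝓝 ν) := by
  refine tendsto_probabilityMeasure_of_dense_span (𝕜 := ℂ)
    (S := Set.range fun q : ℕ × ℤ => toC (char p q.1 q.2)) ?_ ?_
  · refine Metric.dense_iff.mpr fun f ε hε => ?_
    obtain ⟨g, hg, norm_sub_lt⟩ := exists_span_near f hε
    refine ⟨g, ?_, hg⟩
    rw [mem_ball_iff_norm', ContinuousMap.norm_lt_iff _ hε]
    exact norm_sub_lt
  · rintro _ ⟨⟨d, m⟩, rfl⟩
    exact h d m

section Array

variable {ι : Type*} {l : Filter ι} {κ : ι → Type*} [∀ n, Fintype (κ n)] {Ω : ι → Type*}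
  [∀ n, MeasurableSpace (Ω n)] {P : ∀ n, Measure (Ω n)} [∀ n, IsProbabilityMeasure (P n)]
  {X : ∀ n, κ n → Ω n → solenoid p}

theorem tendsto_sum_measureReal_notMem
    (htail : ∀ (d : ℕ) (ε : ℝ), 0 < ε →
      Tendsto (fun n => ∑ k, (P n).real (X n k ⁻¹' largeArgSet p d ε)) l (𝓝 0))
    {U : Set (solenoid p)} (hU : U ∈ 𝓝 1) :
    Tendsto (fun n => ∑ k, (P n).real {ω | X n k ω ∉ U}) l (𝓝 0) := by
  obtain ⟨d, ε, hε, compl_subset⟩ := exists_compl_largeArgSet_subset hU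
  refine squeeze_zero (fun n => Finset.sum_nonneg fun k _ => measureReal_nonneg) (fun n => ?_)
    (htail d ε hε)
  exact Finset.sum_le_sum fun k _ =>
    measureReal_mono (Set.preimage_mono (Set.compl_subset_comm.mp compl_subset))

theorem tendsto_prod_integral_char_sub_prod_charFun [NeZero p]
    (hX : ∀ n k, Measurable (X n k)) (hε : p * ε < Real.pi) (m : ℤ)
    (htail : Tendsto (fun n => ∑ k, (P n).real (X n k ⁻¹' largeArgSet p d ε)) l (𝓝 0)) :
    Tendsto (fun n => ∏ k, ∫ ω, (char p d m (X n k ω) : ℂ) ∂(P n)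
      - ∏ k, charFun ((P n).map fun ω => circleArg ((X n k ω).1 0)) (m / p ^ d)) l (𝓝 0) := by
  refine squeeze_zero_norm (fun n => ?_) (by simpa using htail.const_mul 2)
  have isProbabilityMeasure_map (k : κ n) :
      IsProbabilityMeasure ((P n).map fun ω => circleArg ((X n k ω).1 0)) :=
    Measure.isProbabilityMeasure_map ((measurable_circleArg_coord 0).comp (hX n k)).aemeasurable
  rw [Finset.mul_sum]
  refine (norm_prod_sub_prod_le_sum _ _ _ (fun k _ => ?_) fun k _ => norm_charFun_le_one _).trans
    (Finset.sum_le_sum fun k _ => norm_integral_char_sub_charFun_le (hX n k) hε m)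
  simpa using norm_integral_le_of_norm_le_const (μ := P n)
    (f := fun ω => (char p d m (X n k ω) : ℂ)) (ae_of_all _ fun ω => (Circle.norm_coe _).le)

theorem tendsto_prod_integral_char [Fact p.Prime] (hX : ∀ n k, Measurable (X n k)) {a : solenoid p}
    {b : ℝ≥0} (d : ℕ) (m : ℤ)
    (hmean : Tendsto (fun n => Complex.exp
      (Complex.I / (p : ℂ) ^ d * ((∑ k, ∫ ω, circleArg ((X n k ω).1 0) ∂(P n) : ℝ) : ℂ)))
      l (𝓝 (a.1 d : ℂ)))
    (hvar : Tendsto (fun n => ∑ k, Var[fun ω => circleArg ((X n k ω).1 0); P n]) l (𝓝 (b : ℝ)))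
    (htail : ∀ (d : ℕ) (ε : ℝ), 0 < ε →
      Tendsto (fun n => ∑ k, (P n).real (X n k ⁻¹' largeArgSet p d ε)) l (𝓝 0)) :
    Tendsto (fun n => ∏ k, ∫ ω, (char p d m (X n k ω) : ℂ) ∂(P n)) l
      (𝓝 (∫ y, (char p d m y : ℂ) ∂(Measure.dirac a ∗ₘ (gauss p b : Measure (solenoid p))))) := by
  have hp : (0 : ℝ) < p := by exact_mod_cast (Fact.out : p.Prime).pos
  have measurable_arg (n : ι) (k : κ n) : Measurable fun ω => circleArg ((X n k ω).1 0) :=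
    (measurable_circleArg_coord 0).comp (hX n k)
  have hmean_zpow : Tendsto (fun n => Complex.exp ((m / p ^ d : ℝ)
      * (∑ k, ∫ ω, circleArg ((X n k ω).1 0) ∂(P n) : ℝ) * Complex.I)) l (𝓝 ((a.1 d : ℂ) ^ m)) := by
    refine (hmean.zpow₀ m (Or.inl (Circle.coe_ne_zero _))).congr fun n => ?_
    rw [← Complex.exp_int_mul]
    push_cast
    ring_nf
  have memLp_arg (n : ι) (k : κ n) : MemLp (fun ω => circleArg ((X n k ω).1 0)) 2 (P n) :=
    MemLp.of_bound (measurable_arg n k).aestronglyMeasurable Real.pi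
      (ae_of_all _ fun ω => abs_circleArg_le_pi _)
  have lindeberg (ε : ℝ) (hε : 0 < ε) :=
    tendsto_sum_tailVariance_of_bounded (l := l) (P := P)
      (fun n k => (measurable_arg n k).aemeasurable) (fun n k ω => abs_circleArg_le_pi _)
      (fun ε hε => by simpa [largeArgSet] using htail 0 ε hε) hε
  have char_sub_charFun := tendsto_prod_integral_char_sub_prod_charFun hX
    (by rw [mul_inv_cancel₀ hp.ne']; linarith [Real.pi_gt_three]) m
    (htail d (p : ℝ)⁻¹ (inv_pos.mpr hp))
  rw [integral_char_dirac_mconv_gauss]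
  simpa using char_sub_charFun.add (tendsto_prod_charFun memLp_arg hmean_zpow hvar lindeberg)

end Array

end solenoid

theorem mainTheorem11 (p : ℕ) [Fact p.Prime]
    {Ω : ℕ → Type*} [∀ n, MeasurableSpace (Ω n)]
    (P : ∀ n, Measure (Ω n)) [∀ n, IsProbabilityMeasure (P n)]
    (K : ℕ → ℕ) (X : ∀ n, Fin (K n) → Ω n → solenoid p)
    (hmeas : ∀ n k, Measurable (X n k))
    (hindep : ∀ n, iIndepFun (X n) (P n))
    (a : solenoid p) (b : ℝ≥0)
    (hmean : ∀ d : ℕ, Tendsto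
      (fun n => Complex.exp
        (Complex.I / (p : ℂ) ^ d * ((∑ k, ∫ ω, circleArg ((X n k ω).1 0) ∂(P n) : ℝ) : ℂ)))
      atTop (𝓝 (a.1 d : ℂ)))
    (hvar : Tendsto (fun n => ∑ k, variance (fun ω => circleArg ((X n k ω).1 0)) (P n))
      atTop (𝓝 (b : ℝ)))
    (htail : ∀ (d : ℕ) (ε : ℝ), 0 < ε → Tendsto
      (fun n => ∑ k, (P n).real {ω | ∃ j ≤ d, ε < |circleArg ((X n k ω).1 j)|})
      atTop (𝓝 0)) :
    IsInfinitesimal P K X ∧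
      TendstoInDistribution (fun n ω => ∏ k, X n k ω) atTop id P
        (Measure.dirac a ∗ₘ (solenoid.gauss p b : Measure (solenoid p))) := by
  refine ⟨isInfinitesimal_of_tendsto_sum_measureReal_notMem fun U hU =>
      solenoid.tendsto_sum_measureReal_notMem htail hU,
    fun n => Finset.aemeasurable_fun_prod _ fun k _ => (hmeas n k).aemeasurable, aemeasurable_id,
    solenoid.tendsto_of_tendsto_integral_char fun d m => ?_⟩
  simp only [ProbabilityMeasure.coe_mk, Measure.map_id,
    integral_character_map_prod (fun k => (hmeas _ k).aemeasurable) (hindep _)]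
  exact solenoid.tendsto_prod_integral_char hmeas d m (hmean d) hvar htail
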